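/- For an automorphism $\varphi$ of a group $G$, call $g_1,g_2\in G$ $\varphi$-twisted conjugate if $g_1=hg_2\varphi(h^{-1})$ for some $h\in G$, and let the Reidemeister number $R(\varphi)\in\{1,2,\dots\}\cup\{\infty\}$ be the number of $\varphi$-twisted conjugacy classes. Let $\widehat G_f$ be the set of (unitary) equivalence classes of finite-dimensional irreducible unitary complex representations of $G$, and let $\widehat\varphi\colon\widehat G_f\to\widehat G_f$, $\widehat\varphi([\rho])=[\rho\circ\varphi]$. We say that the finite-dimensional twisted Burnside--Frobenius theorem holds for $G$ if $R(\varphi)=\#\mathrm{Fix}(\widehat\varphi)$ for every automorphism $\varphi$ of $G$ with $R(\varphi)<\infty$. For positive integers $n,k$ let $\mathbb{Z}_n\operatorname{wr}\mathbb{Z}^k=\bigl(\bigoplus_{x\in\mathbb{Z}^k}(\mathbb{Z}_n)_x\bigr)\rtimes_\alpha\mathbb{Z}^k$ be the restricted wreath product, where $\alpha(h)$ maps the summand $(\mathbb{Z}_n)_x$ identically onto $(\mathbb{Z}_n)_{h+x}$. Theorem. Let $k$ and $n$ be positive integers. 1. If $\gcd(n,2)=1$, the finite-dimensional twisted Burnside--Frobenius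 theorem holds for $\mathbb{Z}_{3n}\operatorname{wr}\mathbb{Z}^{2k}$. 2. If $\gcd(n,6)=1$, the finite-dimensional twisted Burnside--Frobenius theorem holds for $\mathbb{Z}_{n}\operatorname{wr}\mathbb{Z}^{k}$. 3. These are exactly the cases in which $R(\varphi)$ can be finite: the group $\mathbb{Z}_n\operatorname{wr}\mathbb{Z}^k$ has an automorphism $\varphi$ with $R(\varphi)<\infty$ if and only if either $n=3m$ and $k=2l$ for some integers $m,l$ with $\gcd(m,2)=1$, or $\gcd(n,6)=1$. -/

import Mathlib

noncomputable section

namespace TwistedBurnside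

section Reidemeister

variable {G : Type*} [Group G]

/-- `g₁` and `g₂` are `φ`-twisted conjugate if `g₁ = h g₂ φ(h⁻¹)` for some `h`. -/
def twistedConj (φ : G ≃* G) : Setoid G where
  r g₁ g₂ := ∃ h : G, g₁ = h * g₂ * φ h⁻¹
  iseqv :=
    { refl := fun g => ⟨1, by simp⟩
      symm := by
        rintro g₁ g₂ ⟨h, rfl⟩
        exact ⟨h⁻¹, by simp [mul_assoc]⟩
      trans := by
        rintro g₁ g₂ g₃ ⟨h, rfl⟩ ⟨h', rfl⟩
        exact ⟨h * h', by simp [mul_assoc]⟩ }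

/-- The Reidemeister number `R(φ)`: the number of `φ`-twisted conjugacy classes. -/
def reidemeisterNumber (φ : G ≃* G) : ℕ∞ :=
  ENat.card (Quotient (twistedConj φ))

end Reidemeister

section UnitaryDual

/-- A finite-dimensional irreducible unitary representation of `G`. -/
structure UnitaryIrrep (G : Type*) [Group G] where
  /-- The underlying complex Hilbert space. -/
  V : Type
  [normed : NormedAddCommGroup V]
  [innerProduct : InnerProductSpace ℂ V]
  [finDim : FiniteDimensional ℂ V]
  /-- The action of `G`. -/
  ρ : Representation ℂ G V
  unitary : ∀ (g : G) (v w : V), inner ℂ (ρ g v) (ρ g w) = inner ℂ v w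
  irreducible : ρ.IsIrreducible

attribute [instance] UnitaryIrrep.normed UnitaryIrrep.innerProduct UnitaryIrrep.finDim

variable {G : Type*} [Group G]

/-- Unitary equivalence of representations. -/
def unitaryEquiv (G : Type*) [Group G] : Setoid (UnitaryIrrep G) where
  r π σ := ∃ T : π.V ≃ₗᵢ[ℂ] σ.V, ∀ (g : G) (v : π.V), T (π.ρ g v) = σ.ρ g (T v)
  iseqv :=
    { refl := fun π => ⟨LinearIsometryEquiv.refl ℂ π.V, fun _ _ => rfl⟩
      symm := by
        rintro π σ ⟨T, hT⟩
        refine ⟨T.symm, fun g v => ?_⟩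
        apply T.injective
        simp [hT]
      trans := by
        rintro π σ τ ⟨T, hT⟩ ⟨S, hS⟩
        exact ⟨T.trans S, fun g v => by simp [hT, hS]⟩ }

/-- The finite-dimensional part of the unitary dual: the set of equivalence classes of
finite-dimensional irreducible unitary representations. -/
def FinUnitaryDual (G : Type*) [Group G] :=
  Quotient (unitaryEquiv G)

/-- A representation and its composite with an automorphism have the same invariant subspaces. -/
def subrepresentationCompIso {V : Type*} [AddCommGroup V] [Module ℂ V]
    (ρ : Representation ℂ G V) (φ : G ≃* G) :
    Subrepresentation (MonoidHom.comp ρ φ.toMonoidHom : Representation ℂ G V) ≃o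
      Subrepresentation ρ where
  toFun W := ⟨W.toSubmodule, fun g v hv => by
    simpa using W.apply_mem_toSubmodule (φ.symm g) hv⟩
  invFun W := ⟨W.toSubmodule, fun g v hv => W.apply_mem_toSubmodule (φ g) hv⟩
  left_inv _ := rfl
  right_inv _ := rfl
  map_rel_iff' := Iff.rfl

/-- The representation `ρ ∘ φ`. -/
def UnitaryIrrep.comp (π : UnitaryIrrep G) (φ : G ≃* G) : UnitaryIrrep G where
  V := π.V
  ρ := MonoidHom.comp π.ρ φ.toMonoidHom
  unitary g v w := π.unitary (φ g) v w
  irreducible := (subrepresentationCompIso π.ρ φ).isSimpleOrder_iff.mpr π.irreducible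

/-- The map `[ρ] ↦ [ρ ∘ φ]` on the finite-dimensional part of the unitary dual. -/
def dualMap (φ : G ≃* G) : FinUnitaryDual G → FinUnitaryDual G :=
  Quotient.map (sa := unitaryEquiv G) (sb := unitaryEquiv G) (fun π => π.comp φ) (by
    rintro π σ ⟨T, hT⟩
    exact ⟨T, fun g v => hT (φ g) v⟩)

/-- The finite-dimensional twisted Burnside–Frobenius theorem holds for `G`: for every
automorphism `φ` with finite Reidemeister number, `R(φ)` equals the number of fixed points
of `[ρ] ↦ [ρ ∘ φ]`. -/
def TBFTf (G : Type*) [Group G] : Prop :=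
  ∀ φ : G ≃* G, reidemeisterNumber φ ≠ ⊤ →
    reidemeisterNumber φ = (Function.fixedPoints (dualMap φ)).encard

end UnitaryDual

section Wreath

/-- The action of `H` on `⨁_{x ∈ H} A_x` which sends the summand `A_x` to `A_{hx}`. -/
def shift (A H : Type*) [AddCommGroup A] [Group H] :
    H →* MulAut (Multiplicative (H →₀ A)) where
  toFun h := AddEquiv.toMultiplicative (Finsupp.domCongr (Equiv.mulLeft h))
  map_one' := by
    ext f x
    simp [Finsupp.equivMapDomain_apply]
    rfl
  map_mul' a b := by
    ext f x
    simp only [Equiv.mulLeft_mul, MulAut.mul_apply]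
    rfl

/-- The restricted wreath product `A wr H` of an (additively written) abelian group `A`
and a group `H`. -/
abbrev RestrictedWreath (A H : Type*) [AddCommGroup A] [Group H] :=
  Multiplicative (H →₀ A) ⋊[shift A H] H

/-- The lamplighter-type group `ℤ_n wr ℤ^k`. -/
abbrev Lamplighter (n k : ℕ) :=
  RestrictedWreath (ZMod n) (Multiplicative (Fin k → ℤ))

end Wreath

end TwistedBurnside

end

/-!
The base group is preserved by every automorphism `φ`, which therefore induces an automorphism `M`
of `H = ℤ^k` and an automorphism `ψ` of the base group semilinear over `M`. If `R(φ)` is finite,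
then so are the coinvariants `H / (1 - M) H`, so that `M` has no nontrivial fixed points, and all
cokernels of the operators `1 - t^x ψ`, where `t^x` is the translation by `x`.

Modulo a prime `p ∣ n` the group ring `𝔽_p[H]` has only trivial units, so `ψ` becomes monomial,
`δ_y ↦ c δ_{a + M y}`. The positive powers of a nontrivial `y` lie in distinct orbits of `M`, so the
cokernel of `1 - t^{-a} ψ` can be finite only if `y` has a period `s` under `M` with `c ^ s ≠ 1`.
Conversely, these periods make all operators `1 - t^x ψ` surjective modulo each `p`, hence
surjective. Twisted conjugacy classes are then the fibres of the projection to the coinvariants,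
and `R(φ)` is the number of their characters. By Burnside's density theorem these characters are
the only `φ`-invariant irreducible representations: for an intertwiner `T` of `ρ` and `ρ ∘ φ` the
function `g ↦ tr (T ρ(g))` is constant on twisted conjugacy classes.

For `p = 2` no `c` satisfies `c ^ s ≠ 1`. For `p = 3` only `c = -1` can, with `s` odd, so `M` has
odd finite order, and in odd rank it would fix a nonzero vector. Examples with `R(φ)` finite are
given by `M = -1`, `c = 2` if `n` is prime to `6`, and by `1 + M + M² = 0`, `c = -1` if `n` is odd
and `k` is even.
-/

open scoped TensorProduct
open SemidirectProduct Function

noncomputable section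

namespace TwistedBurnside

section IrreducibleRepresentation

theorem eq_zero_of_forall_trace_mul_eq_zero {k V : Type*} [Field k] [AddCommGroup V] [Module k V]
    [FiniteDimensional k V] {X : Module.End k V}
    (hX : ∀ Y, LinearMap.trace k V (X * Y) = 0) : X = 0 := by
  ext w
  refine (Module.forall_dual_apply_eq_zero_iff k (X w)).1 fun f => ?_
  have hcomp : X * dualTensorHom k V V (f ⊗ₜ w) = dualTensorHom k V V (f ⊗ₜ X w) := by
    ext v
    simp
  simpa [hcomp] using hX (dualTensorHom k V V (f ⊗ₜ w))

variable {k G V : Type*} [Field k] [IsAlgClosed k] [Group G] [AddCommGroup V] [Module k V]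
  [FiniteDimensional k V] {ρ : Representation k G V}

theorem asAlgebraHom_surjective_of_isIrreducible (hρ : ρ.IsIrreducible) :
    Surjective ρ.asAlgebraHom := by
  classical
  intro Y
  have : IsSimpleModule (MonoidAlgebra k G) ρ.asModule :=
    (Representation.irreducible_iff_isSimpleModule_asModule ρ).mp hρ
  have : FiniteDimensional k ρ.asModule := inferInstanceAs (FiniteDimensional k V)
  have schur := IsSimpleModule.algebraMap_end_bijective_of_isAlgClosed
    (A := MonoidAlgebra k G) (V := ρ.asModule) k
  let e := ρ.asModuleEquiv
  let Y' : Module.End (Module.End (MonoidAlgebra k G) ρ.asModule) ρ.asModule :=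
    { toFun := fun v => e.symm (Y (e v))
      map_add' := by simp
      map_smul' := fun T v => by
        obtain ⟨c, rfl⟩ := schur.2 T
        simp }
  let b := Module.finBasis k V
  obtain ⟨r, hr⟩ := jacobson_density Y' (Finset.univ.image fun i => e.symm (b i))
  refine ⟨r, b.ext fun i => ?_⟩
  have hri := congrArg e (hr (e.symm (b i)) (Finset.mem_image_of_mem _ (Finset.mem_univ i)))
  simpa [Y', e] using hri.symm

theorem eq_zero_of_forall_trace_mul_apply_eq_zero (hρ : ρ.IsIrreducible) {X : Module.End k V}
    (hX : ∀ g, LinearMap.trace k V (X * ρ g) = 0) : X = 0 := by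
  refine eq_zero_of_forall_trace_mul_eq_zero fun Y => ?_
  obtain ⟨a, rfl⟩ := asAlgebraHom_surjective_of_isIrreducible hρ Y
  induction a using MonoidAlgebra.induction_linear with
  | zero => simp
  | add a b ha hb => rw [map_add, mul_add, map_add, ha, hb, add_zero]
  | single g c => simp [hX]

theorem exists_eq_algebraMap_of_forall_commute (hρ : ρ.IsIrreducible) {f : Module.End k V}
    (hf : ∀ g, f * ρ g = ρ g * f) : ∃ c : k, f = algebraMap k (Module.End k V) c := by
  obtain ⟨c, hc⟩ :=
    (Representation.IsIrreducible.algebraMap_intertwiningMap_bijective_of_isAlgClosed (ρ := ρ)).2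
      ⟨f, hf⟩
  exact ⟨c, (congrArg Representation.IntertwiningMap.toLinearMap hc).symm⟩

end IrreducibleRepresentation

section Character

variable {G : Type*} [Group G]

/-- The one-dimensional unitary representation on `ℂ` given by a unitary character. -/
def charIrrep (χ : G →* Circle) : UnitaryIrrep G where
  V := ℂ
  ρ := (Algebra.lmul ℂ ℂ : ℂ →* Module.End ℂ ℂ).comp (Circle.coeHom.comp χ)
  unitary g v w := by
    have hχ : (χ g : ℂ) * (starRingEnd ℂ) (χ g : ℂ) = 1 := by
      rw [Complex.mul_conj, Circle.normSq_coe, Complex.ofReal_one]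
    change (χ g : ℂ) * w * (starRingEnd ℂ) ((χ g : ℂ) * v) = w * (starRingEnd ℂ) v
    rw [map_mul, mul_mul_mul_comm, hχ, one_mul]
  irreducible :=
    { exists_pair_ne := ⟨⊥, ⊤, fun h => bot_ne_top (α := Submodule ℂ ℂ)
        (congrArg Subrepresentation.toSubmodule h)⟩
      eq_bot_or_eq_top := fun W => (eq_bot_or_eq_top (α := Ideal ℂ) W.toSubmodule).imp
        (fun h => Subrepresentation.toSubmodule_injective h)
        (fun h => Subrepresentation.toSubmodule_injective h) }

/-- The point of the unitary dual given by a unitary character. -/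
def charClass (χ : G →* Circle) : FinUnitaryDual G :=
  Quotient.mk (unitaryEquiv G) (charIrrep χ)

theorem charClass_injective : Injective (charClass (G := G)) := by
  intro χ₁ χ₂ h
  obtain ⟨T, hT⟩ : (unitaryEquiv G).r (charIrrep χ₁) (charIrrep χ₂) := Quotient.exact h
  change ℂ ≃ₗᵢ[ℂ] ℂ at T
  change ∀ (g : G) (v : ℂ), T ((χ₁ g : ℂ) * v) = (χ₂ g : ℂ) * T v at hT
  have hT1 : T 1 ≠ 0 := T.map_ne_zero_iff.2 one_ne_zero
  ext g
  refine mul_right_cancel₀ hT1 ?_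
  rw [← hT, ← smul_eq_mul, ← smul_eq_mul, map_smul]

namespace UnitaryIrrep

variable (σ : UnitaryIrrep G)

instance nontrivial : Nontrivial σ.V := by
  by_contra hV
  rw [not_nontrivial_iff_subsingleton] at hV
  obtain ⟨W₁, W₂, hW⟩ := σ.irreducible.exists_pair_ne
  exact hW (Subrepresentation.toSubmodule_injective (Subsingleton.elim _ _))

theorem norm_rho_apply (g : G) (v : σ.V) : ‖σ.ρ g v‖ = ‖v‖ := by
  rw [norm_eq_sqrt_re_inner (𝕜 := ℂ), σ.unitary, ← norm_eq_sqrt_re_inner]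

theorem exists_character_of_commute (hσ : ∀ g h, σ.ρ g * σ.ρ h = σ.ρ h * σ.ρ g) :
    ∃ χ : G →* Circle, ∀ g v, σ.ρ g v = (χ g : ℂ) • v := by
  choose c hc using fun g => exists_eq_algebraMap_of_forall_commute σ.irreducible (hσ g)
  have hinj : Injective (algebraMap ℂ (Module.End ℂ σ.V)) := FaithfulSMul.algebraMap_injective _ _
  let c' : G →* ℂ :=
    { toFun := c
      map_one' := hinj (by rw [← hc, map_one, map_one])
      map_mul' := fun g h => hinj (by rw [map_mul, ← hc, ← hc, ← hc, map_mul]) }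
  have hnorm : ∀ g, ‖c g‖ = 1 := fun g => by
    obtain ⟨v, hv⟩ := exists_norm_eq σ.V zero_le_one
    simpa [hc, norm_smul, hv] using σ.norm_rho_apply g v
  refine ⟨c'.codRestrict (Submonoid.unitSphere ℂ) fun g => mem_sphere_zero_iff_norm.2 (hnorm g),
    fun g v => ?_⟩
  rw [hc]
  rfl

theorem charIrrep_equiv_of_forall_apply_eq_smul {χ : G →* Circle}
    (hχ : ∀ g v, σ.ρ g v = (χ g : ℂ) • v) : (unitaryEquiv G).r (charIrrep χ) σ := by
  obtain ⟨v₀, hv₀⟩ := exists_norm_eq σ.V zero_le_one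
  let W : Subrepresentation σ.ρ :=
    { toSubmodule := Submodule.span ℂ {v₀}
      apply_mem_toSubmodule := fun g v hv => by
        rw [hχ]
        exact Submodule.smul_mem _ _ hv }
  have hW : W.toSubmodule = ⊤ := by
    rcases σ.irreducible.eq_bot_or_eq_top W with h | h
    · have : v₀ = 0 := Submodule.span_singleton_eq_bot.1 (congrArg (·.toSubmodule) h)
      simp [this] at hv₀
    · exact congrArg (·.toSubmodule) h
  let S : ℂ →ₗᵢ[ℂ] σ.V :=
    { toLinearMap := LinearMap.toSpanSingleton ℂ σ.V v₀
      norm_map' := fun r => by simp [norm_smul, hv₀] }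
  have hS : Surjective S := fun v =>
    Submodule.mem_span_singleton.1 (show v ∈ W.toSubmodule from hW ▸ Submodule.mem_top)
  refine ⟨LinearIsometryEquiv.ofSurjective S hS, fun g (v : ℂ) => ?_⟩
  change ((χ g : ℂ) * v) • v₀ = σ.ρ g (v • v₀)
  rw [hχ, mul_smul]

end UnitaryIrrep

end Character

section TwistedClassesAsFibres

variable {G A : Type*} [Group G] [CommGroup A] {φ : G ≃* G} {π : G →* A}

theorem apply_eq_of_twistedConj_eq_ker (hφ : twistedConj φ = Setoid.ker π) (g : G) :
    π (φ g) = π g := by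
  have hg : (twistedConj φ).r (g * φ g⁻¹) 1 := ⟨g, by rw [mul_one]⟩
  rw [hφ] at hg
  have hπ : π (g * φ g⁻¹) = π 1 := hg
  rw [map_mul, map_inv, map_inv, map_one, mul_inv_eq_one] at hπ
  exact hπ.symm

theorem rho_eq_one_of_fixed (hφ : twistedConj φ = Setoid.ker π) {σ : UnitaryIrrep G}
    (hσ : (unitaryEquiv G).r (σ.comp φ) σ) {n : G} (hn : π n = 1) : σ.ρ n = 1 := by
  obtain ⟨S, hS⟩ := hσ
  let T : σ.V ≃ₗ[ℂ] σ.V := S.symm.toLinearEquiv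
  have hT : ∀ g, σ.ρ (φ g) * (T : Module.End ℂ σ.V) = (T : Module.End ℂ σ.V) * σ.ρ g := by
    intro g
    ext v
    have hSg := hS g (S.symm v)
    rw [S.apply_symm_apply] at hSg
    exact (S.symm_apply_eq.2 hSg.symm).symm
  -- The function `g ↦ tr (T ρ(g))` is constant on twisted conjugacy classes.
  have htrace : ∀ g, LinearMap.trace ℂ σ.V ((T : Module.End ℂ σ.V) * σ.ρ (g * n)) =
      LinearMap.trace ℂ σ.V ((T : Module.End ℂ σ.V) * σ.ρ g) := by
    intro g
    obtain ⟨h, hh⟩ : (twistedConj φ).r (g * n) g := by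
      rw [hφ]
      exact show π (g * n) = π g by rw [map_mul, hn, mul_one]
    rw [hh, map_mul σ.ρ, ← mul_assoc, LinearMap.trace_mul_comm, ← mul_assoc, hT, mul_assoc,
      ← map_mul σ.ρ, inv_mul_cancel_left]
  have hzero : (σ.ρ n - 1) * (T : Module.End ℂ σ.V) = 0 := by
    refine eq_zero_of_forall_trace_mul_apply_eq_zero σ.irreducible fun g => ?_
    rw [mul_assoc, LinearMap.trace_mul_comm, mul_assoc, mul_sub, ← map_mul σ.ρ, mul_one, mul_sub,
      map_sub, htrace, sub_self]
  ext v
  simpa [sub_eq_zero] using LinearMap.congr_fun hzero (T.symm v)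

theorem exists_character_of_fixed (hπ : Surjective π) (hφ : twistedConj φ = Setoid.ker π)
    {σ : UnitaryIrrep G} (hσ : (unitaryEquiv G).r (σ.comp φ) σ) :
    ∃ χ : A →* Circle, (unitaryEquiv G).r (charIrrep (χ.comp π)) σ := by
  have hker : π.ker ≤ MonoidHom.ker σ.ρ := fun _ hg => rho_eq_one_of_fixed hφ hσ hg
  have hcomm : ∀ g h, σ.ρ g * σ.ρ h = σ.ρ h * σ.ρ g := fun g h => by
    rw [← map_mul, ← map_mul, MonoidHom.eq_iff]
    refine hker ?_
    rw [MonoidHom.mem_ker, map_mul, map_inv, map_mul, map_mul, mul_comm (π h), inv_mul_cancel]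
  obtain ⟨χ, hχ⟩ := σ.exists_character_of_commute hcomm
  have hχker : π.ker ≤ χ.ker := fun g hg => by
    obtain ⟨v, hv⟩ := exists_ne (0 : σ.V)
    refine Circle.ext (smul_left_injective ℂ hv ?_)
    simp only [← hχ, rho_eq_one_of_fixed hφ hσ hg, Module.End.one_apply, Circle.coe_one, one_smul]
  refine ⟨MonoidHom.liftOfSurjective π hπ ⟨χ, hχker⟩, ?_⟩
  rw [MonoidHom.liftOfRightInverse_comp]
  exact σ.charIrrep_equiv_of_forall_apply_eq_smul hχ

theorem fixedPoints_dualMap_eq_range (hπ : Surjective π) (hφ : twistedConj φ = Setoid.ker π) :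
    fixedPoints (dualMap φ) = Set.range fun χ : A →* Circle => charClass (χ.comp π) := by
  ext x
  constructor
  · induction x using Quotient.inductionOn with | _ σ =>
    intro hσ
    obtain ⟨χ, hχ⟩ := exists_character_of_fixed hπ hφ (Quotient.exact hσ)
    exact ⟨χ, Quotient.sound hχ⟩
  · rintro ⟨χ, rfl⟩
    refine Quotient.sound ⟨LinearIsometryEquiv.refl ℂ ℂ, fun g (v : ℂ) => ?_⟩
    change (χ (π (φ g)) : ℂ) * v = (χ (π g) : ℂ) * v
    rw [apply_eq_of_twistedConj_eq_ker hφ]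

theorem card_monoidHom_circle [Finite A] : ENat.card (A →* Circle) = ENat.card A :=
  ENat.card_congr ((toUnits : Circle ≃* Circleˣ).monoidHomCongrRightEquiv.trans
    (CommGroup.monoidHom_mulEquiv_of_hasEnoughRootsOfUnity A Circle).some.toEquiv)

theorem encard_fixedPoints_dualMap [Finite A] (hπ : Surjective π)
    (hφ : twistedConj φ = Setoid.ker π) : (fixedPoints (dualMap φ)).encard = ENat.card A := by
  have hinj : Injective fun χ : A →* Circle => charClass (χ.comp π) := fun _ _ h =>
    (MonoidHom.cancel_right hπ).1 (charClass_injective h)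
  rw [fixedPoints_dualMap_eq_range hπ hφ, ← Set.image_univ, hinj.encard_image, Set.encard_univ,
    card_monoidHom_circle]

theorem reidemeisterNumber_eq_card (hπ : Surjective π) (hφ : twistedConj φ = Setoid.ker π) :
    reidemeisterNumber φ = ENat.card A := by
  rw [reidemeisterNumber, hφ]
  exact ENat.card_congr (Setoid.quotientKerEquivOfSurjective π hπ)

end TwistedClassesAsFibres

section BaseGroup

variable {A H : Type*} [AddCommGroup A] [CommGroup H]

/-- Translation by `x` on `⨁_{y ∈ H} A_y`: the additive form of `shift`. -/
def translate (x : H) : (H →₀ A) ≃+ (H →₀ A) := Finsupp.domCongr (Equiv.mulLeft x)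

@[simp]
theorem translate_single (x y : H) (r : A) :
    translate x (Finsupp.single y r) = Finsupp.single (x * y) r := by
  simp [translate, Finsupp.equivMapDomain_single]

theorem translate_eq_mapDomain (x : H) (f : H →₀ A) :
    translate x f = Finsupp.mapDomain (x * ·) f := by
  simp [translate, Finsupp.equivMapDomain_eq_mapDomain]

/-- The element of the base group of the wreath product given by a finitely supported function;
it turns the additive notation for such functions into the multiplicative one. -/
def lamp (f : H →₀ A) : RestrictedWreath A H := inl (Multiplicative.ofAdd f)

theorem lamp_add (f g : H →₀ A) : lamp (f + g) = lamp f * lamp g := map_mul inl _ _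

theorem lamp_neg (f : H →₀ A) : lamp (-f) = (lamp f)⁻¹ := map_inv inl _

theorem lamp_zero : lamp (0 : H →₀ A) = 1 := map_one inl

@[simp]
theorem lamp_right (f : H →₀ A) : (lamp f).right = 1 := rfl

theorem lamp_injective : Injective (lamp : (H →₀ A) → RestrictedWreath A H) :=
  fun _ _ h => Multiplicative.ofAdd.injective (inl_injective h)

theorem exists_lamp_of_right_eq_one {g : RestrictedWreath A H} (hg : g.right = 1) :
    ∃ f, g = lamp f :=
  ⟨Multiplicative.toAdd g.left, SemidirectProduct.ext rfl hg⟩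

theorem mul_lamp (g : RestrictedWreath A H) (f : H →₀ A) :
    g * lamp f = lamp (translate g.right f) * g := by
  ext1
  · simp only [lamp, mul_left, left_inl, right_inl, map_one, MulAut.one_apply]
    exact mul_comm _ _
  · simp

theorem conj_lamp (g : RestrictedWreath A H) (f : H →₀ A) :
    g * lamp f * g⁻¹ = lamp (translate g.right f) := by
  rw [mul_lamp, mul_inv_cancel_right]

theorem lamp_commute_lamp (f g : H →₀ A) : Commute (lamp f) (lamp g) := by
  rw [commute_iff_eq, ← lamp_add, add_comm, lamp_add]

theorem translate_sub_single_ne [IsMulTorsionFree H] {x : H} (hx : x ≠ 1) {a : A} (ha : a ≠ 0) :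
    translate x (Finsupp.single 1 a - Finsupp.single x a) ≠
      Finsupp.single 1 a - Finsupp.single x a := by
  have hx2 : x * x ≠ 1 := by simpa [← sq, pow_eq_one_iff] using hx
  intro h
  refine ha ?_
  simpa [hx, hx2, Finsupp.single_apply] using (DFunLike.congr_fun h 1).symm

theorem right_eq_one_iff_forall_commute_conj [Nontrivial A] [IsMulTorsionFree H]
    {g : RestrictedWreath A H} : g.right = 1 ↔ ∀ y, Commute (y * g * y⁻¹) g := by
  constructor
  · intro hg y
    obtain ⟨f, rfl⟩ := exists_lamp_of_right_eq_one hg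
    rw [conj_lamp]
    exact lamp_commute_lamp _ _
  · intro hg
    by_contra hx
    obtain ⟨a, ha⟩ := exists_ne (0 : A)
    refine translate_sub_single_ne hx ha (lamp_injective ?_)
    have hconj : lamp (Finsupp.single 1 a) * g * (lamp (Finsupp.single 1 a))⁻¹ =
        lamp (Finsupp.single 1 a - Finsupp.single g.right a) * g := by
      rw [← lamp_neg, mul_assoc, mul_lamp, ← mul_assoc, ← lamp_add, map_neg, translate_single,
        mul_one, sub_eq_add_neg]
    have hcomm := hg (lamp (Finsupp.single 1 a))
    rw [hconj, commute_iff_eq, ← mul_assoc, mul_lamp] at hcomm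
    exact (mul_right_cancel (mul_right_cancel hcomm)).symm

end BaseGroup

section Automorphism

variable {A H : Type*} [AddCommGroup A] [CommGroup H]

/-- The automorphism `φ` of the wreath product preserves the base group, on which it acts by `ψ`,
and acts by `M` on the quotient `H`. -/
structure Induces (φ : RestrictedWreath A H ≃* RestrictedWreath A H) (M : MulAut H)
    (ψ : (H →₀ A) ≃+ (H →₀ A)) : Prop where
  map_right (g : RestrictedWreath A H) : (φ g).right = M g.right
  map_lamp (f : H →₀ A) : φ (lamp f) = lamp (ψ f)

theorem map_lamp_right_eq_one [IsMulTorsionFree H]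
    (φ : RestrictedWreath A H ≃* RestrictedWreath A H) (f : H →₀ A) :
    (φ (lamp f)).right = 1 := by
  rcases subsingleton_or_nontrivial A with hA | hA
  · rw [Subsingleton.elim f 0, lamp_zero, map_one, one_right]
  · rw [right_eq_one_iff_forall_commute_conj]
    intro y
    have hcomm := right_eq_one_iff_forall_commute_conj.1 (lamp_right f) (φ.symm y)
    simpa using hcomm.map φ

theorem map_right_eq_map_inr_right [IsMulTorsionFree H]
    (φ : RestrictedWreath A H ≃* RestrictedWreath A H) (g : RestrictedWreath A H) :
    (φ g).right = (φ (inr g.right)).right := by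
  conv_lhs => rw [← inl_left_mul_inr_right g, map_mul, mul_right]
  rw [show (φ (inl g.left)).right = 1 from map_lamp_right_eq_one φ (Multiplicative.toAdd g.left),
    one_mul]

theorem exists_induces [IsMulTorsionFree H]
    (φ : RestrictedWreath A H ≃* RestrictedWreath A H) : ∃ M ψ, Induces φ M ψ := by
  choose ψ hψ using fun f => exists_lamp_of_right_eq_one (map_lamp_right_eq_one φ f)
  choose ψ' hψ' using fun f => exists_lamp_of_right_eq_one (map_lamp_right_eq_one φ.symm f)
  let M : MulAut H :=
    { toFun := fun x => (φ (inr x)).right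
      invFun := fun x => (φ.symm (inr x)).right
      left_inv := fun x => by simp [← map_right_eq_map_inr_right]
      right_inv := fun x => by simp [← map_right_eq_map_inr_right]
      map_mul' := fun x y => by simp }
  let Ψ : (H →₀ A) ≃+ (H →₀ A) :=
    { toFun := ψ
      invFun := ψ'
      left_inv := fun f => lamp_injective (by rw [← hψ', ← hψ, φ.symm_apply_apply])
      right_inv := fun f => lamp_injective (by rw [← hψ, ← hψ', φ.apply_symm_apply])
      map_add' := fun f g => lamp_injective (by rw [← hψ, lamp_add, lamp_add, map_mul, hψ, hψ]) }
  exact ⟨M, Ψ, map_right_eq_map_inr_right φ, hψ⟩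

/-- The subgroup of all `z / M z`, whose quotient is the group of coinvariants of `M`. -/
def coboundaries (M : MulAut H) : Subgroup H := (MonoidHom.id H / M.toMonoidHom).range

theorem mem_coboundaries {M : MulAut H} {x : H} : x ∈ coboundaries M ↔ ∃ z, z / M z = x :=
  Iff.rfl

/-- The projection of the wreath product to the coinvariants of `M`. -/
def toCoinvariants (A : Type*) [AddCommGroup A] (M : MulAut H) :
    RestrictedWreath A H →* H ⧸ coboundaries M :=
  (QuotientGroup.mk' (coboundaries M)).comp rightHom

theorem toCoinvariants_surjective (M : MulAut H) : Surjective (toCoinvariants A M) :=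
  (QuotientGroup.mk'_surjective _).comp rightHom_surjective

/-- The operator `1 - t^x ψ` on the base group, where `t^x` is the translation by `x`. -/
def twistedDiff (ψ : (H →₀ A) ≃+ (H →₀ A)) (x : H) : (H →₀ A) →+ (H →₀ A) :=
  AddMonoidHom.id _ - (translate x).toAddMonoidHom.comp ψ.toAddMonoidHom

theorem twistedDiff_apply (ψ : (H →₀ A) ≃+ (H →₀ A)) (x : H) (f : H →₀ A) :
    twistedDiff ψ x f = f - translate x (ψ f) := rfl

namespace Induces

variable {φ : RestrictedWreath A H ≃* RestrictedWreath A H} {M : MulAut H}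
  {ψ : (H →₀ A) ≃+ (H →₀ A)}

theorem map_translate (hφ : Induces φ M ψ) (y : H) (f : H →₀ A) :
    ψ (translate y f) = translate (M y) (ψ f) := by
  have h := congrArg φ (mul_lamp (inr y : RestrictedWreath A H) f)
  rw [map_mul, map_mul, hφ.map_lamp, hφ.map_lamp, mul_lamp, hφ.map_right, right_inr] at h
  exact (lamp_injective (mul_right_cancel h)).symm

theorem toCoinvariants_apply (hφ : Induces φ M ψ) (g : RestrictedWreath A H) :
    toCoinvariants A M (φ g) = toCoinvariants A M g := by
  change ((φ g).right : H ⧸ coboundaries M) = (g.right : H ⧸ coboundaries M)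
  rw [hφ.map_right, QuotientGroup.eq, mem_coboundaries]
  exact ⟨g.right, by rw [div_eq_mul_inv, mul_comm]⟩

theorem toCoinvariants_eq_of_twistedConj (hφ : Induces φ M ψ) {g₁ g₂ : RestrictedWreath A H}
    (h : (twistedConj φ).r g₁ g₂) : toCoinvariants A M g₁ = toCoinvariants A M g₂ := by
  obtain ⟨h, rfl⟩ := h
  rw [map_mul, map_mul, hφ.toCoinvariants_apply, map_inv, mul_inv_cancel_comm]

theorem lamp_twistedDiff_mul (hφ : Induces φ M ψ) (f : H →₀ A) (g : RestrictedWreath A H) :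
    lamp (twistedDiff ψ g.right f) * g = lamp f * g * φ (lamp f)⁻¹ := by
  rw [mul_assoc, ← lamp_neg, hφ.map_lamp, mul_lamp, ← mul_assoc, ← lamp_add, map_neg, map_neg,
    ← sub_eq_add_neg, twistedDiff_apply]

theorem exists_twistedConj_lamp_mul (hφ : Induces φ M ψ) {g₁ g₂ : RestrictedWreath A H}
    (h : toCoinvariants A M g₁ = toCoinvariants A M g₂) :
    ∃ d, (twistedConj φ).r (lamp d * g₁) g₂ := by
  obtain ⟨z, hz⟩ : ∃ z, z / M z = g₂.right⁻¹ * g₁.right :=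
    mem_coboundaries.1 (QuotientGroup.eq.1 h.symm)
  have hright : (inr z * g₂ * φ (inr z)⁻¹ * g₁⁻¹).right = 1 := by
    simp only [mul_right, inv_right, hφ.map_right, right_inr, map_inv]
    rw [mul_right_comm z, ← div_eq_mul_inv z, hz, mul_comm g₂.right⁻¹, inv_mul_cancel_right,
      mul_inv_cancel]
  obtain ⟨d, hd⟩ := exists_lamp_of_right_eq_one hright
  exact ⟨d, inr z, by rw [← hd, inv_mul_cancel_right]⟩

theorem twistedConj_eq_ker_toCoinvariants (hφ : Induces φ M ψ)
    (hsurj : ∀ x, Surjective (twistedDiff ψ x)) :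
    twistedConj φ = Setoid.ker (toCoinvariants A M) := by
  ext g₁ g₂
  refine ⟨hφ.toCoinvariants_eq_of_twistedConj, fun h => ?_⟩
  obtain ⟨d, hd⟩ := hφ.exists_twistedConj_lamp_mul h
  obtain ⟨f, hf⟩ := hsurj g₁.right d
  have hg₁ : (twistedConj φ).r (lamp d * g₁) g₁ := ⟨lamp f, by rw [← hf, hφ.lamp_twistedDiff_mul]⟩
  exact (twistedConj φ).trans ((twistedConj φ).symm hg₁) hd

theorem sub_mem_range_twistedDiff (hφ : Induces φ M ψ) (hM : ∀ z, M z = z → z = 1) {x : H}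
    {d₁ d₂ : H →₀ A} (h : (twistedConj φ).r (lamp d₁ * inr x) (lamp d₂ * inr x)) :
    d₁ - d₂ ∈ (twistedDiff ψ x).range := by
  obtain ⟨h, hh⟩ := h
  have hright := congrArg SemidirectProduct.right hh
  simp only [mul_right, lamp_right, right_inr, hφ.map_right, inv_right, map_inv, one_mul] at hright
  have hone : h.right = 1 := by
    refine hM _ ?_
    rw [mul_right_comm, right_eq_mul, mul_inv_eq_one] at hright
    exact hright.symm
  obtain ⟨f, rfl⟩ := exists_lamp_of_right_eq_one hone
  have hlamp := hφ.lamp_twistedDiff_mul f (lamp d₂ * inr x)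
  rw [← hh, mul_right, lamp_right, right_inr, one_mul, ← mul_assoc, ← lamp_add] at hlamp
  exact ⟨f, by rw [← lamp_injective (mul_right_cancel hlamp), add_sub_cancel_right]⟩

theorem finite_coinvariants (hφ : Induces φ M ψ) (hR : reidemeisterNumber φ ≠ ⊤) :
    Finite (H ⧸ coboundaries M) := by
  have : Finite (Quotient (twistedConj φ)) := ENat.card_lt_top.1 hR.lt_top
  refine Finite.of_surjective (α := Quotient (twistedConj φ))
    (Quotient.lift (toCoinvariants A M) fun _ _ => hφ.toCoinvariants_eq_of_twistedConj) ?_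
  exact Quotient.lift_surjective _ _ (toCoinvariants_surjective M)

theorem finite_quotient_range_twistedDiff (hφ : Induces φ M ψ) (hM : ∀ z, M z = z → z = 1)
    (hR : reidemeisterNumber φ ≠ ⊤) (x : H) : Finite ((H →₀ A) ⧸ (twistedDiff ψ x).range) := by
  have : Finite (Quotient (twistedConj φ)) := ENat.card_lt_top.1 hR.lt_top
  refine Finite.of_injective
    (fun q => Quotient.mk (twistedConj φ) (lamp q.out * inr x)) fun q₁ q₂ h => ?_
  rw [← QuotientAddGroup.out_eq' q₁, ← QuotientAddGroup.out_eq' q₂,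
    QuotientAddGroup.eq_iff_sub_mem]
  exact hφ.sub_mem_range_twistedDiff hM (Quotient.exact h)

end Induces

end Automorphism

section Lattice

variable {R L : Type*} [CommRing R] [AddCommGroup L] [Module R L]

theorem exists_dual_apply_dvd [IsPrincipalIdealRing R] (v : L) :
    ∃ f : Module.Dual R L, ∀ g : Module.Dual R L, f v ∣ g v := by
  let I : Ideal R := LinearMap.range (Module.Dual.eval R L v)
  obtain ⟨f, hf⟩ : Submodule.IsPrincipal.generator I ∈ I := Submodule.IsPrincipal.generator_mem I
  refine ⟨f, fun g => ?_⟩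
  rw [← Module.Dual.eval_apply, hf]
  exact (Submodule.IsPrincipal.mem_iff_generator_dvd I).1 ⟨g, rfl⟩

theorem dvd_of_map_smul_eq [IsDomain R] [IsPrincipalIdealRing R] [Module.Projective R L]
    {N : Module.End R L} {v : L} (hv : v ≠ 0) {j l : R} (h : N (j • v) = l • v) : j ∣ l := by
  obtain ⟨f, hf⟩ := exists_dual_apply_dvd (R := R) v
  have hfv : f v ≠ 0 := fun h0 => hv <| (Module.forall_dual_apply_eq_zero_iff R v).1 fun g =>
    zero_dvd_iff.1 (h0 ▸ hf g)
  refine (mul_dvd_mul_iff_right hfv).1 ?_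
  calc j * f v ∣ j * (f ∘ₗ N) v := mul_dvd_mul_left j (hf _)
    _ = l * f v := by rw [← smul_eq_mul, ← map_smul, LinearMap.comp_apply, h, map_smul, smul_eq_mul]

theorem injective_of_finite_quotient_range {L : Type*} [AddCommGroup L] [Module.Free ℤ L]
    [Module.Finite ℤ L] (f : Module.End ℤ L) [Finite (L ⧸ LinearMap.range f)] : Injective f := by
  have hrange := (Submodule.finiteQuotient_iff (LinearMap.range f)).1 inferInstance
  have hker := (LinearMap.ker f).finrank_quotient_add_finrank
  rw [f.quotKerEquivRange.finrank_eq, hrange] at hker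
  exact LinearMap.ker_eq_bot.1 (Submodule.finrank_eq_zero.1 (Nat.add_eq_left.1 hker))

open Matrix

section Determinant

variable {ι R : Type*} [Fintype ι] [DecidableEq ι] [CommRing R]

theorem transpose_mul_sum_pow_mul {A : Matrix ι ι R} {S : ℕ} (hA : A ^ S = 1) :
    Aᵀ * (∑ i ∈ Finset.range S, (A ^ i)ᵀ * A ^ i) * A =
      ∑ i ∈ Finset.range S, (A ^ i)ᵀ * A ^ i := by
  have hshift : Aᵀ * (∑ i ∈ Finset.range S, (A ^ i)ᵀ * A ^ i) * A =
      ∑ i ∈ Finset.range S, (A ^ (i + 1))ᵀ * A ^ (i + 1) := by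
    rw [Finset.mul_sum, Finset.sum_mul]
    refine Finset.sum_congr rfl fun i _ => ?_
    rw [pow_succ, transpose_mul]
    simp only [Matrix.mul_assoc]
  have hsum := Finset.sum_range_succ' (fun i => (A ^ i)ᵀ * A ^ i) S
  rw [Finset.sum_range_succ, hA, pow_zero] at hsum
  rw [hshift, add_right_cancel hsum]

variable [LinearOrder R] [IsStrictOrderedRing R]

theorem det_sum_transpose_mul_pow_ne_zero (A : Matrix ι ι R) {S : ℕ} (hS : S ≠ 0) :
    (∑ i ∈ Finset.range S, (A ^ i)ᵀ * A ^ i).det ≠ 0 := by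
  intro hdet
  obtain ⟨v, hv, hBv⟩ := exists_mulVec_eq_zero_iff.2 hdet
  have hsum : ∑ i ∈ Finset.range S, (A ^ i *ᵥ v) ⬝ᵥ (A ^ i *ᵥ v) = 0 := by
    calc ∑ i ∈ Finset.range S, (A ^ i *ᵥ v) ⬝ᵥ (A ^ i *ᵥ v)
        = v ⬝ᵥ (∑ i ∈ Finset.range S, (A ^ i)ᵀ * A ^ i) *ᵥ v := by
          simp only [sum_mulVec, dotProduct_sum, ← mulVec_mulVec, dotProduct_mulVec,
            vecMul_transpose]
      _ = 0 := by rw [hBv, dotProduct_zero]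
  have hzero := (Finset.sum_eq_zero_iff_of_nonneg fun i _ =>
    Finset.sum_nonneg fun j _ => mul_self_nonneg ((A ^ i *ᵥ v) j)).1 hsum 0
      (Finset.mem_range.2 (Nat.pos_of_ne_zero hS))
  rw [pow_zero, one_mulVec] at hzero
  exact hv (dotProduct_self_eq_zero.1 hzero)

theorem det_one_sub_eq_zero_of_odd (hι : Odd (Fintype.card ι)) {A : Matrix ι ι R} {S : ℕ}
    (hS : Odd S) (hA : A ^ S = 1) : (1 - A).det = 0 := by
  have hdetA : A.det = 1 := hS.strictMono_pow.injective (by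
    simp only [← det_pow, hA, det_one, one_pow])
  set B := ∑ i ∈ Finset.range S, (A ^ i)ᵀ * A ^ i
  -- `B` is an `A`-invariant inner product, so `B (1 - A) = AᵀBA - BA = -(1 - A)ᵀ B A`; in odd
  -- dimension the two sides have opposite determinants.
  have hAB : Aᵀ * B * A = B := transpose_mul_sum_pow_mul hA
  have hB : B * (1 - A) = -((1 - A)ᵀ * B * A) := by
    rw [transpose_sub, transpose_one, sub_mul, sub_mul, one_mul, hAB, mul_sub, mul_one, neg_sub]
  have hdet := congrArg det hB
  rw [det_neg, hι.neg_one_pow, det_mul, det_mul, det_mul, det_transpose, hdetA] at hdet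
  refine (mul_eq_zero.1 (?_ : B.det * (1 - A).det = 0)).resolve_left
    (det_sum_transpose_mul_pow_ne_zero A hS.pos.ne')
  linarith

end Determinant

theorem exists_ne_zero_map_eq_self_of_odd [LinearOrder R] [IsStrictOrderedRing R]
    [Module.Free R L] [Module.Finite R L] (hL : Odd (Module.finrank R L)) {f : Module.End R L}
    {S : ℕ} (hS : Odd S) (hf : f ^ S = 1) : ∃ v ≠ 0, f v = v := by
  let b := Module.finBasis R L
  have hmatrix : LinearMap.toMatrix b b f ^ S = 1 := by
    rw [LinearMap.toMatrix_pow, hf, LinearMap.toMatrix_one]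
  have hdet : LinearMap.det (1 - f) = 0 := by
    rw [← LinearMap.det_toMatrix b, map_sub, LinearMap.toMatrix_one]
    exact det_one_sub_eq_zero_of_odd (by rwa [Fintype.card_fin]) hS hmatrix
  obtain ⟨v, hv, hv0⟩ := Submodule.exists_mem_ne_zero_of_ne_bot
    (LinearMap.det_eq_zero_iff_ker_ne_bot.1 hdet)
  exact ⟨v, hv0, (sub_eq_zero.1 hv).symm⟩

theorem exists_odd_pow_eq_one {R L : Type*} [Semiring R] [AddCommMonoid L] [Module R L]
    [Module.Finite R L] {f : Module.End R L} (hf : ∀ v, ∃ s : ℕ, Odd s ∧ (f ^ s) v = v) :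
    ∃ S : ℕ, Odd S ∧ f ^ S = 1 := by
  obtain ⟨t, ht⟩ : (⊤ : Submodule R L).FG := Module.Finite.fg_top
  choose s hs hfix using hf
  refine ⟨∏ v ∈ t, s v, Finset.prod_induction _ _ (fun _ _ => Odd.mul) odd_one fun v _ => hs v,
    LinearMap.ext_on ht fun v hv => ?_⟩
  obtain ⟨r, hr⟩ := Finset.dvd_prod_of_mem s hv
  rw [hr, pow_mul, Module.End.pow_apply, iterate_fixed (hfix v), Module.End.one_apply]

variable {H : Type*} [CommGroup H]

/-- An automorphism of an abelian group, written multiplicatively, as an endomorphism of the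
corresponding `ℤ`-module. -/
def additiveEnd : MulAut H →* Module.End ℤ (Additive H) where
  toFun M := (MonoidHom.toAdditive M.toMonoidHom).toIntLinearMap
  map_one' := rfl
  map_mul' _ _ := rfl

theorem additiveEnd_apply (M : MulAut H) (z : H) :
    additiveEnd M (Additive.ofMul z) = Additive.ofMul (M z) := rfl

variable [Group.FG H]

theorem finite_quotient_of_pow_mem {N : Subgroup H} {e : ℕ} (he : e ≠ 0) (hN : ∀ z, z ^ e ∈ N) :
    Finite (H ⧸ N) := by
  refine CommGroup.finite_of_fg_isMulTorsion _ fun g => ?_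
  obtain ⟨z, rfl⟩ := QuotientGroup.mk_surjective g
  exact isOfFinOrder_iff_pow_eq_one.2 ⟨e, Nat.pos_of_ne_zero he,
    (QuotientGroup.eq_one_iff _).2 (hN z)⟩

variable [IsMulTorsionFree H]

theorem eq_one_of_map_eq_self (M : MulAut H) [Finite (H ⧸ coboundaries M)] {z : H}
    (hz : M z = z) : z = 1 := by
  have : Finite (Additive H ⧸ LinearMap.range (1 - additiveEnd M)) := by
    refine Finite.of_surjective (Quotient.map' (s₁ := QuotientGroup.leftRel (coboundaries M))
      Additive.ofMul fun a b hab => ?_) (Quotient.map_surjective _ Additive.ofMul.surjective)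
    obtain ⟨w, hw⟩ := mem_coboundaries.1 (QuotientGroup.leftRel_apply.1 hab)
    exact QuotientAddGroup.leftRel_apply.2 ⟨Additive.ofMul w, congrArg Additive.ofMul hw⟩
  have hinj := injective_of_finite_quotient_range (1 - additiveEnd M)
  refine Additive.ofMul.injective (hinj ?_)
  rw [ofMul_one, map_zero, LinearMap.sub_apply, additiveEnd_apply, hz, Module.End.one_apply,
    sub_self]

theorem dvd_of_map_pow_eq_pow (N : MulAut H) {y : H} (hy : y ≠ 1) {j l : ℕ}
    (h : N (y ^ j) = y ^ l) : j ∣ l := by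
  rw [← Int.natCast_dvd_natCast]
  refine dvd_of_map_smul_eq (N := additiveEnd N) (v := Additive.ofMul y) hy ?_
  rw [natCast_zsmul, natCast_zsmul, ← ofMul_pow, additiveEnd_apply, h, ofMul_pow]

theorem eq_of_map_pow_eq_pow (N : MulAut H) {y : H} (hy : y ≠ 1) {j l : ℕ}
    (h : N (y ^ j) = y ^ l) : j = l :=
  (dvd_of_map_pow_eq_pow N hy h).antisymm <|
    dvd_of_map_pow_eq_pow N⁻¹ hy (by rw [← h, MulAut.inv_apply_self])

end Lattice

section GroupAlgebra

variable {K H : Type*} [Semiring K] [NoZeroDivisors K] [MulOneClass H]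

theorem mul_eq_one_of_uniqueMul {u v : MonoidAlgebra K H} (huv : u * v = 1) {a b : H}
    (ha : a ∈ u.coeff.support) (hb : b ∈ v.coeff.support)
    (hab : UniqueMul u.coeff.support v.coeff.support a b) : a * b = 1 := by
  by_contra hne
  have hcoeff := MonoidAlgebra.coeff_mul_mul_of_uniqueMul hab
  rw [huv, MonoidAlgebra.one_def, MonoidAlgebra.coeff_single, Finsupp.single_eq_of_ne hne] at hcoeff
  exact mul_ne_zero (Finsupp.mem_support_iff.1 ha) (Finsupp.mem_support_iff.1 hb) hcoeff.symm

theorem exists_eq_single_of_mul_eq_one [Nontrivial K] [TwoUniqueProds H]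
    {u v : MonoidAlgebra K H} (huv : u * v = 1) :
    ∃ a, ∃ c ≠ 0, u = MonoidAlgebra.single a c := by
  have hu : u.coeff.support.Nonempty := by
    rw [Finsupp.support_nonempty_iff, Ne, MonoidAlgebra.coeff_eq_zero]
    exact left_ne_zero_of_mul_eq_one huv
  have hv : v.coeff.support.Nonempty := by
    rw [Finsupp.support_nonempty_iff, Ne, MonoidAlgebra.coeff_eq_zero]
    exact right_ne_zero_of_mul_eq_one huv
  have hcard : u.coeff.support.card * v.coeff.support.card ≤ 1 := by
    by_contra! hlt
    -- Two distinct unique products would both have to equal `1`.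
    obtain ⟨⟨a, b⟩, hab, ⟨a', b'⟩, hab', hne, hU, hU'⟩ :=
      TwoUniqueProds.uniqueMul_of_one_lt_card hlt
    rw [Finset.mem_product] at hab hab'
    have heq : a' * b' = a * b := (mul_eq_one_of_uniqueMul huv hab'.1 hab'.2 hU').trans
      (mul_eq_one_of_uniqueMul huv hab.1 hab.2 hU).symm
    obtain ⟨rfl, rfl⟩ := hU hab'.1 hab'.2 heq
    exact hne rfl
  have hone : u.coeff.support.card = 1 :=
    Nat.eq_one_of_mul_eq_one_right (hcard.antisymm (Nat.mul_pos hu.card_pos hv.card_pos))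
  obtain ⟨a, c, hc, huc⟩ := Finsupp.card_support_eq_one'.1 hone
  exact ⟨a, c, hc, MonoidAlgebra.coeff_injective huc⟩

end GroupAlgebra

section Monomial

section CommSemiring

variable {K X : Type*} [CommSemiring K]

/-- The monomial operator `δ_y ↦ c δ_{P y}` on the free module with basis `X`. -/
def monomialMap (P : X → X) (c : K) : Module.End K (X →₀ K) := c • Finsupp.lmapDomain K K P

theorem monomialMap_apply (P : X → X) (c : K) (f : X →₀ K) :
    monomialMap P c f = c • Finsupp.mapDomain P f := rfl

@[simp]
theorem monomialMap_single (P : X → X) (c : K) (y : X) (r : K) :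
    monomialMap P c (Finsupp.single y r) = Finsupp.single (P y) (c * r) := by
  rw [monomialMap_apply, Finsupp.mapDomain_single, Finsupp.smul_single, smul_eq_mul]

theorem monomialMap_mul (P Q : X → X) (c d : K) :
    monomialMap P c * monomialMap Q d = monomialMap (P ∘ Q) (c * d) := by
  ext : 2
  simp

theorem monomialMap_pow (P : X → X) (c : K) (s : ℕ) :
    monomialMap P c ^ s = monomialMap P^[s] (c ^ s) := by
  induction s with
  | zero => ext : 2; simp
  | succ s ih => rw [pow_succ, ih, monomialMap_mul, iterate_succ, pow_succ]

theorem coeff_single_mul_ofCoeff {H : Type*} [Mul H] (a : H) (c : K) (f : H →₀ K) :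
    (MonoidAlgebra.single a c * MonoidAlgebra.ofCoeff f).coeff = monomialMap (a * ·) c f := by
  induction f using Finsupp.induction_linear with
  | zero => simp
  | add f g hf hg =>
    rw [MonoidAlgebra.ofCoeff_add, mul_add, MonoidAlgebra.coeff_add, hf, hg, map_add]
  | single y r =>
    rw [MonoidAlgebra.ofCoeff_single, MonoidAlgebra.single_mul_single,
      MonoidAlgebra.coeff_single, monomialMap_single]

end CommSemiring

theorem translate_monomialMap {K H : Type*} [CommRing K] [CommGroup H] (x : H) (P : H → H)
    (c : K) (f : H →₀ K) :
    translate x (monomialMap P c f) = monomialMap (fun y => x * P y) c f := by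
  rw [monomialMap_apply, monomialMap_apply, translate_eq_mapDomain, Finsupp.mapDomain_smul,
    ← Finsupp.mapDomain_comp, comp_def]

theorem single_mem_range_one_sub_monomialMap {K X : Type*} [CommRing K] {P : X → X} {c : K}
    {y : X} {s : ℕ} (hy : P^[s] y = y) (hc : IsUnit (1 - c ^ s)) (r : K) :
    Finsupp.single y r ∈ LinearMap.range (1 - monomialMap P c) := by
  obtain ⟨u, hu⟩ := hc
  have hgeom : (1 - monomialMap P c) * ∑ i ∈ Finset.range s, monomialMap P c ^ i =
      1 - monomialMap P^[s] (c ^ s) := by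
    rw [← monomialMap_pow]
    exact mul_neg_geom_sum (monomialMap P c) s
  refine ⟨(∑ i ∈ Finset.range s, monomialMap P c ^ i) (Finsupp.single y (↑u⁻¹ * r)), ?_⟩
  rw [← Module.End.mul_apply, hgeom, LinearMap.sub_apply, Module.End.one_apply, monomialMap_single,
    hy, ← Finsupp.single_sub, ← one_sub_mul, ← hu, Units.mul_inv_cancel_left]

theorem one_sub_monomialMap_surjective {K X : Type*} [CommRing K] {P : X → X} {c : K}
    (hP : ∀ y, ∃ s : ℕ, P^[s] y = y ∧ IsUnit (1 - c ^ s)) :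
    Surjective (1 - monomialMap P c : Module.End K (X →₀ K)) := by
  intro d
  induction d using Finsupp.induction_linear with
  | zero => exact zero_mem (LinearMap.range (1 - monomialMap P c))
  | add f g hf hg => exact (LinearMap.range (1 - monomialMap P c)).add_mem hf hg
  | single y r =>
    obtain ⟨s, hs, hc⟩ := hP y
    exact single_mem_range_one_sub_monomialMap hs hc r

section Orbit

variable {K X : Type*} [CommRing K]

theorem zpow_eq_zpow_of_zpow_apply_eq {P : Equiv.Perm X} {c : Kˣ} {y : X}
    (hy : ∀ s : ℕ, P^[s] y = y → c ^ s = 1) {i j : ℤ} (h : (P ^ i) y = (P ^ j) y) :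
    c ^ i = c ^ j := by
  wlog hij : j ≤ i
  · exact (this hy h.symm (le_of_not_ge hij)).symm
  obtain ⟨s, rfl⟩ := Int.exists_add_of_le hij
  rw [zpow_add, Equiv.Perm.mul_apply, (P ^ j).injective.eq_iff, zpow_natCast,
    ← Equiv.Perm.iterate_eq_pow] at h
  rw [zpow_add, zpow_natCast, hy s h, mul_one]

/-- The functional sending `δ_{P^i y}` to `c^{-i}` and the other basis vectors to `0`; it is
`1 - monomialMap P c`-invariant as soon as it is well defined. -/
def orbitFunctional (P : Equiv.Perm X) (c : Kˣ) (y : X) : Module.Dual K (X →₀ K) :=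
  Finsupp.linearCombination K
    (extend (fun i : ℤ => (P ^ i) y) (fun i => ((c ^ (-i) : Kˣ) : K)) 0)

theorem orbitFunctional_single_of_not_sameCycle {P : Equiv.Perm X} (c : Kˣ) {y z : X}
    (hz : ¬ P.SameCycle y z) (r : K) : orbitFunctional P c y (Finsupp.single z r) = 0 := by
  rw [orbitFunctional, Finsupp.linearCombination_single, extend_apply' _ _ _ hz, Pi.zero_apply,
    smul_zero]

theorem orbitFunctional_single_zpow {P : Equiv.Perm X} {c : Kˣ} {y : X}
    (hy : ∀ s : ℕ, P^[s] y = y → c ^ s = 1) (i : ℤ) (r : K) :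
    orbitFunctional P c y (Finsupp.single ((P ^ i) y) r) = r * (c ^ (-i) : Kˣ) := by
  have hfactors : FactorsThrough (fun i : ℤ => ((c ^ (-i) : Kˣ) : K)) fun i : ℤ => (P ^ i) y :=
    fun i j hij => by simp only [zpow_neg, zpow_eq_zpow_of_zpow_apply_eq hy hij]
  rw [orbitFunctional, Finsupp.linearCombination_single, hfactors.extend_apply, smul_eq_mul]

theorem orbitFunctional_one_sub_monomialMap {P : Equiv.Perm X} {c : Kˣ} {y : X}
    (hy : ∀ s : ℕ, P^[s] y = y → c ^ s = 1) (f : X →₀ K) :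
    orbitFunctional P c y ((1 - monomialMap P (c : K)) f) = 0 := by
  induction f using Finsupp.induction_linear with
  | zero => simp
  | add f g hf hg => rw [map_add, map_add, hf, hg, add_zero]
  | single z r =>
    rw [LinearMap.sub_apply, Module.End.one_apply, monomialMap_single, map_sub]
    by_cases hz : P.SameCycle y z
    · obtain ⟨i, rfl⟩ := hz
      rw [← Equiv.Perm.mul_apply, ← zpow_one_add, orbitFunctional_single_zpow hy,
        orbitFunctional_single_zpow hy, mul_right_comm, ← Units.val_mul, ← zpow_one_add,
        neg_add_rev, add_neg_cancel_comm_assoc, mul_comm, sub_self]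
    · rw [orbitFunctional_single_of_not_sameCycle c hz,
        orbitFunctional_single_of_not_sameCycle c (mt Equiv.Perm.sameCycle_apply_right.1 hz),
        sub_zero]

theorem exists_iterate_eq_of_finite_quotient [Nontrivial K] {P : Equiv.Perm X} {c : Kˣ}
    [Finite ((X →₀ K) ⧸ LinearMap.range (1 - monomialMap P (c : K)))] {y : ℕ → X}
    (hy : ∀ i j, P.SameCycle (y i) (y j) → i = j) :
    ∃ i, ∃ s : ℕ, P^[s] (y i) = y i ∧ c ^ s ≠ 1 := by
  by_contra! hbad
  obtain ⟨i, j, hij, h⟩ := Finite.exists_ne_map_eq_of_infinite fun i =>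
    (LinearMap.range (1 - monomialMap P (c : K))).mkQ (Finsupp.single (y i) 1)
  obtain ⟨f, hf⟩ := (Submodule.Quotient.eq _).1 h
  refine one_ne_zero (α := K) ?_
  calc (1 : K) = orbitFunctional P c (y i) (Finsupp.single (y i) 1 - Finsupp.single (y j) 1) := by
        rw [map_sub, orbitFunctional_single_of_not_sameCycle c fun h => hij (hy i j h)]
        simpa using (orbitFunctional_single_zpow (hbad i) 0 1).symm
    _ = 0 := by rw [← hf, orbitFunctional_one_sub_monomialMap (hbad i)]

end Orbit

end Monomial

section Period

variable {H : Type*} [CommGroup H] [IsMulTorsionFree H]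

theorem exists_iterate_mulAut_eq_of_finite_quotient [Group.FG H] [Nontrivial H] {K : Type*}
    [CommRing K] [Nontrivial K] {M : MulAut H} {c : Kˣ}
    [Finite ((H →₀ K) ⧸ LinearMap.range (1 - monomialMap M (c : K)))] (y : H) :
    ∃ s : ℕ, M^[s] y = y ∧ c ^ s ≠ 1 := by
  wlog hy : y ≠ 1 generalizing y
  · obtain ⟨y', hy'⟩ := exists_ne (1 : H)
    obtain ⟨s, -, hs⟩ := this y' hy'
    exact ⟨s, by rw [not_not.1 hy, iterate_map_one], hs⟩
  let P : Equiv.Perm H := MulAut.toPerm H M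
  have : Finite ((H →₀ K) ⧸ LinearMap.range (1 - monomialMap P (c : K))) := ‹_›
  obtain ⟨i, s, hs, hc⟩ := exists_iterate_eq_of_finite_quotient (P := P) (c := c)
    (y := fun i => y ^ (i + 1)) fun i j ⟨t, ht⟩ => by
      rw [← map_zpow] at ht
      exact Nat.succ_injective (eq_of_map_pow_eq_pow (M ^ t) hy ht)
  refine ⟨s, pow_left_injective i.succ_ne_zero ?_, hc⟩
  exact (iterate_map_pow M s y (i + 1)).symm.trans hs

theorem exists_iterate_mul_apply_eq {M : MulAut H} [Finite (H ⧸ coboundaries M)] {p : ℕ → Prop}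
    (hM : ∀ y, ∃ s : ℕ, M^[s] y = y ∧ p s) (b y : H) :
    ∃ s : ℕ, (fun y => b * M y)^[s] y = y ∧ p s := by
  let e := Nat.card (H ⧸ coboundaries M)
  obtain ⟨z, hz⟩ : ∃ z, z / M z = b ^ e := by
    rw [← mem_coboundaries, ← QuotientGroup.eq_one_iff, QuotientGroup.mk_pow, pow_card_eq_one']
  -- As `b ^ e` is a coboundary, the map `y ↦ y ^ e / z` intertwines `b * M` with `M`.
  let Θ : H → H := fun y => y ^ e / z
  have hΘ : Semiconj Θ (fun y => b * M y) M := fun y => by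
    change (b * M y) ^ e / z = M (y ^ e / z)
    rw [mul_pow, ← hz, map_div, map_pow, mul_comm, mul_div_assoc, div_div_cancel_left,
      ← div_eq_mul_inv]
  obtain ⟨s, hs, hps⟩ := hM (Θ y)
  refine ⟨s, pow_left_injective (Nat.card_pos (α := H ⧸ coboundaries M)).ne'
    (div_left_injective (b := z) ?_), hps⟩
  exact (hΘ.iterate_right s y).trans hs

end Period

section Reduction

variable {H : Type*} {n p : ℕ}

/-- Reduction of coefficients modulo a divisor. -/
def redMod (H : Type*) (hpn : p ∣ n) : (H →₀ ZMod n) →+ (H →₀ ZMod p) :=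
  Finsupp.mapRange.addMonoidHom (ZMod.castHom hpn (ZMod p)).toAddMonoidHom

theorem redMod_apply (hpn : p ∣ n) (f : H →₀ ZMod n) (x : H) :
    redMod H hpn f x = ZMod.castHom hpn (ZMod p) (f x) := rfl

@[simp]
theorem redMod_single (hpn : p ∣ n) (x : H) (r : ZMod n) :
    redMod H hpn (Finsupp.single x r) = Finsupp.single x (ZMod.castHom hpn (ZMod p) r) :=
  Finsupp.mapRange_single (hf := map_zero _)

theorem redMod_surjective (hpn : p ∣ n) : Surjective (redMod H hpn) :=
  Finsupp.mapRange_surjective _ (map_zero _) (ZMod.castHom_surjective hpn)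

theorem redMod_translate [CommGroup H] (hpn : p ∣ n) (x : H) (f : H →₀ ZMod n) :
    redMod H hpn (translate x f) = translate x (redMod H hpn f) := by
  rw [translate_eq_mapDomain, translate_eq_mapDomain]
  exact (Finsupp.mapDomain_mapRange _ _ _ (map_zero _) (map_add _)).symm

theorem exists_eq_nsmul_of_redMod_eq_zero (hpn : p ∣ n) {f : H →₀ ZMod n}
    (hf : redMod H hpn f = 0) : ∃ d, f = p • d := by
  refine ⟨f.mapRange (fun r => ((r.cast / p : ℤ) : ZMod n)) (by simp), ?_⟩
  ext x
  have hdvd : (p : ℤ) ∣ (f x).cast := by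
    rw [← ZMod.intCast_zmod_eq_zero_iff_dvd, ← map_intCast (ZMod.castHom hpn (ZMod p)),
      ZMod.intCast_zmod_cast, ← redMod_apply, hf, Finsupp.zero_apply]
  rw [Finsupp.smul_apply, Finsupp.mapRange_apply, nsmul_eq_mul, ← Int.cast_natCast, ← Int.cast_mul,
    Int.mul_ediv_cancel' hdvd, ZMod.intCast_zmod_cast]

theorem exists_add_nsmul_of_forall_prime {E : Type*} [AddCommGroup E] {I : AddSubgroup E} {m : ℕ}
    (hm : m ≠ 0) (hI : ∀ p : ℕ, p.Prime → p ∣ m → ∀ d : E, ∃ f ∈ I, ∃ d', d = f + p • d') (d : E) :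
    ∃ f ∈ I, ∃ d', d = f + m • d' := by
  induction m using Nat.recOnMul generalizing d with
  | zero => exact absurd rfl hm
  | one => exact ⟨0, I.zero_mem, d, by rw [one_smul, zero_add]⟩
  | prime p hp => exact hI p hp dvd_rfl d
  | mul a b ha hb =>
    obtain ⟨f, hf, d', rfl⟩ := ha (left_ne_zero_of_mul hm)
      (fun p hp hpa => hI p hp (hpa.mul_right b)) d
    obtain ⟨f', hf', d'', rfl⟩ := hb (right_ne_zero_of_mul hm)
      (fun p hp hpb => hI p hp (hpb.mul_left a)) d'
    exact ⟨f + a • f', I.add_mem hf (I.nsmul_mem hf' a), d'', by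
      rw [smul_add, smul_smul, add_assoc]⟩

theorem surjective_of_forall_redMod_surjective (hn : n ≠ 0)
    {T : (H →₀ ZMod n) →+ (H →₀ ZMod n)}
    (hT : ∀ p (hpn : p ∣ n), p.Prime → Surjective fun f => redMod H hpn (T f)) : Surjective T := by
  intro d
  obtain ⟨_, ⟨f, rfl⟩, d', rfl⟩ := exists_add_nsmul_of_forall_prime (I := T.range) hn
    (fun p hp hpn d => by
      obtain ⟨f, hf⟩ := hT p hpn hp (redMod H hpn d)
      obtain ⟨d', hd'⟩ := exists_eq_nsmul_of_redMod_eq_zero hpn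
        (f := d - T f) (by rw [map_sub, sub_eq_zero]; exact hf.symm)
      exact ⟨T f, ⟨f, rfl⟩, d', by rw [← hd', add_sub_cancel]⟩) d
  have hd' : n • d' = 0 := by
    ext
    simp
  exact ⟨f, by rw [hd', add_zero]⟩

theorem redMod_eq_mul_mapDomain [CommGroup H] (hpn : p ∣ n) {M : MulAut H}
    {ψ : (H →₀ ZMod n) →+ (H →₀ ZMod n)}
    (hψ : ∀ y f, ψ (translate y f) = translate (M y) (ψ f)) (f : H →₀ ZMod n) :
    redMod H hpn (ψ f) = (MonoidAlgebra.ofCoeff (redMod H hpn (ψ (Finsupp.single 1 1))) *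
      MonoidAlgebra.ofCoeff (Finsupp.mapDomain M (redMod H hpn f))).coeff := by
  induction f using Finsupp.induction_linear with
  | zero => simp
  | add f g hf hg =>
    rw [map_add, map_add, map_add, Finsupp.mapDomain_add, MonoidAlgebra.ofCoeff_add, mul_add,
      MonoidAlgebra.coeff_add, hf, hg]
  | single y r =>
    obtain ⟨r, rfl⟩ := ZMod.intCast_surjective r
    have hsingle : Finsupp.single y (r : ZMod n) = r • translate y (Finsupp.single 1 1) := by
      rw [translate_single, mul_one, Finsupp.smul_single, zsmul_one]
    rw [hsingle, map_zsmul, map_zsmul, map_zsmul, hψ, redMod_translate, redMod_translate,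
      redMod_single, map_one, translate_single, mul_one, Finsupp.mapDomain_smul,
      Finsupp.mapDomain_single, MonoidAlgebra.ofCoeff_smul, mul_smul_comm, MonoidAlgebra.coeff_smul,
      MonoidAlgebra.ofCoeff_single, mul_comm, coeff_single_mul_ofCoeff, monomialMap_apply, one_smul,
      translate_eq_mapDomain]

variable [CommGroup H] {M : MulAut H}

theorem exists_redMod_eq_monomialMap [TwoUniqueProds H] [Fact p.Prime] (hpn : p ∣ n)
    {ψ : (H →₀ ZMod n) ≃+ (H →₀ ZMod n)}
    (hψ : ∀ y f, ψ (translate y f) = translate (M y) (ψ f)) :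
    ∃ (a : H) (c : (ZMod p)ˣ), ∀ f,
      redMod H hpn (ψ f) = monomialMap (fun y => a * M y) (c : ZMod p) (redMod H hpn f) := by
  have hmul := redMod_eq_mul_mapDomain (ψ := ψ.toAddMonoidHom) hpn hψ
  obtain ⟨a, c, hc, hac⟩ := exists_eq_single_of_mul_eq_one <| MonoidAlgebra.coeff_injective <|
    (hmul (ψ.symm (Finsupp.single 1 1))).symm.trans (by
      simp only [AddEquiv.toAddMonoidHom_eq_coe, AddMonoidHom.coe_coe, AddEquiv.apply_symm_apply,
        redMod_single, map_one, MonoidAlgebra.one_def, MonoidAlgebra.coeff_single])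
  refine ⟨a, Units.mk0 c hc, fun f => ?_⟩
  calc redMod H hpn (ψ f) = monomialMap (a * ·) c (Finsupp.mapDomain M (redMod H hpn f)) := by
        rw [← coeff_single_mul_ofCoeff, ← hac]
        exact hmul f
    _ = monomialMap (fun y => a * M y) c (redMod H hpn f) := by
        rw [monomialMap_apply, ← Finsupp.mapDomain_comp, comp_def, monomialMap_apply]

end Reduction

section FiniteReidemeister

variable {H : Type*} [CommGroup H] {n p : ℕ} {M : MulAut H} {ψ : (H →₀ ZMod n) ≃+ (H →₀ ZMod n)}
  {φ : RestrictedWreath (ZMod n) H ≃* RestrictedWreath (ZMod n) H}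

theorem redMod_twistedDiff {hpn : p ∣ n} {a : H} {c : ZMod p}
    (hψ : ∀ f, redMod H hpn (ψ f) = monomialMap (fun y => a * M y) c (redMod H hpn f))
    (x : H) (f : H →₀ ZMod n) :
    redMod H hpn (twistedDiff ψ x f) =
      (1 - monomialMap (fun y => x * (a * M y)) c : Module.End (ZMod p) (H →₀ ZMod p))
        (redMod H hpn f) := by
  rw [twistedDiff_apply, map_sub, redMod_translate, hψ, translate_monomialMap]
  rfl

variable [Group.FG H] [IsMulTorsionFree H] [Nontrivial H]

theorem Induces.exists_redMod_eq_monomialMap_and_period [Fact p.Prime]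
    (hφ : Induces φ M ψ) (hR : reidemeisterNumber φ ≠ ⊤) (hpn : p ∣ n) :
    ∃ (a : H) (c : (ZMod p)ˣ),
      (∀ f, redMod H hpn (ψ f) =
        monomialMap (fun y => a * M y) (c : ZMod p) (redMod H hpn f)) ∧
      ∀ y, ∃ s : ℕ, M^[s] y = y ∧ c ^ s ≠ 1 := by
  have := hφ.finite_coinvariants hR
  obtain ⟨a, c, hac⟩ := exists_redMod_eq_monomialMap hpn hφ.map_translate
  have := hφ.finite_quotient_range_twistedDiff (fun _ => eq_one_of_map_eq_self M) hR a⁻¹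
  let Q := 1 - monomialMap M (c : ZMod p)
  have hfin : Finite ((H →₀ ZMod p) ⧸ LinearMap.range Q) := by
    refine Finite.of_surjective (QuotientAddGroup.lift (twistedDiff ψ a⁻¹).range
      ((LinearMap.range Q).mkQ.toAddMonoidHom.comp (redMod H hpn)) ?_) ?_
    · rintro _ ⟨f, rfl⟩
      refine (Submodule.Quotient.mk_eq_zero _).2 ⟨redMod H hpn f, ?_⟩
      rw [redMod_twistedDiff hac]
      simp only [inv_mul_cancel_left]
      rfl
    · exact QuotientAddGroup.lift_surjective_of_surjective _ _
        ((Submodule.mkQ_surjective _).comp (redMod_surjective hpn)) _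
  exact ⟨a, c, hac, exists_iterate_mulAut_eq_of_finite_quotient⟩

theorem Induces.twistedDiff_surjective (hn : n ≠ 0)
    (hφ : Induces φ M ψ) (hR : reidemeisterNumber φ ≠ ⊤) (x : H) :
    Surjective (twistedDiff ψ x) := by
  have := hφ.finite_coinvariants hR
  refine surjective_of_forall_redMod_surjective hn fun p hpn hp => ?_
  have : Fact p.Prime := ⟨hp⟩
  obtain ⟨a, c, hac, hperiod⟩ := hφ.exists_redMod_eq_monomialMap_and_period hR hpn
  simp only [redMod_twistedDiff hac, ← mul_assoc]
  refine Surjective.comp (one_sub_monomialMap_surjective fun y => ?_) (redMod_surjective hpn)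
  obtain ⟨s, hs, hcs⟩ := exists_iterate_mul_apply_eq hperiod (x * a) y
  exact ⟨s, hs, (sub_ne_zero.2 fun h => hcs (Units.ext h.symm)).isUnit⟩

theorem not_two_dvd_of_reidemeisterNumber_ne_top (hR : reidemeisterNumber φ ≠ ⊤) : ¬ 2 ∣ n := by
  intro h2
  obtain ⟨M, ψ, hφ⟩ := exists_induces φ
  obtain ⟨-, c, -, hperiod⟩ := hφ.exists_redMod_eq_monomialMap_and_period hR h2
  obtain ⟨s, -, hs⟩ := hperiod 1
  exact hs (Subsingleton.elim _ _)

theorem tbftf_restrictedWreath : TBFTf (RestrictedWreath (ZMod n) H) := by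
  intro φ hR
  have hn : n ≠ 0 := fun h => not_two_dvd_of_reidemeisterNumber_ne_top hR (h ▸ dvd_zero 2)
  obtain ⟨M, ψ, hφ⟩ := exists_induces φ
  have := hφ.finite_coinvariants hR
  have hker := hφ.twistedConj_eq_ker_toCoinvariants (hφ.twistedDiff_surjective hn hR)
  exact (reidemeisterNumber_eq_card (toCoinvariants_surjective M) hker).trans
    (encard_fixedPoints_dualMap (toCoinvariants_surjective M) hker).symm

theorem even_finrank_of_three_dvd (hR : reidemeisterNumber φ ≠ ⊤) (h3 : 3 ∣ n) :
    Even (Module.finrank ℤ (Additive H)) := by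
  by_contra hodd
  obtain ⟨M, ψ, hφ⟩ := exists_induces φ
  have := hφ.finite_coinvariants hR
  have : Fact (Nat.Prime 3) := ⟨Nat.prime_three⟩
  obtain ⟨-, c, -, hperiod⟩ := hφ.exists_redMod_eq_monomialMap_and_period hR h3
  have hc : c ^ 2 = 1 := ZMod.units_pow_card_sub_one_eq_one 3 c
  obtain ⟨S, hS, hMS⟩ := exists_odd_pow_eq_one (f := additiveEnd M) fun v => by
    obtain ⟨s, hs, hcs⟩ := hperiod v.toMul
    refine ⟨s, Nat.not_even_iff_odd.1 fun ⟨r, hr⟩ => hcs ?_, ?_⟩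
    · rw [hr, ← two_mul, pow_mul, hc, one_pow]
    · rw [Module.End.pow_apply]
      exact hs
  obtain ⟨v, hv, hfix⟩ := exists_ne_zero_map_eq_self_of_odd (Nat.not_even_iff_odd.1 hodd) hS hMS
  exact hv (eq_one_of_map_eq_self M (z := v.toMul) hfix)

end FiniteReidemeister

section Existence

variable {H : Type*} [CommGroup H] {n : ℕ}

/-- The automorphism of the base group acting on basis vectors by `δ_y ↦ c δ_{M y}`. -/
def monomialBase (M : MulAut H) (c : (ZMod n)ˣ) : (H →₀ ZMod n) ≃+ (H →₀ ZMod n) :=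
  (Finsupp.domCongr M.toEquiv).trans (DistribMulAction.toAddEquiv (H →₀ ZMod n) c)

theorem monomialBase_apply (M : MulAut H) (c : (ZMod n)ˣ) (f : H →₀ ZMod n) :
    monomialBase M c f = monomialMap M (c : ZMod n) f := by
  change c • Finsupp.equivMapDomain M.toEquiv f = _
  rw [Finsupp.equivMapDomain_eq_mapDomain]
  rfl

theorem monomialBase_translate (M : MulAut H) (c : (ZMod n)ˣ) (x : H) (f : H →₀ ZMod n) :
    monomialBase M c (translate x f) = translate (M x) (monomialBase M c f) := by
  rw [monomialBase_apply, monomialBase_apply, translate_monomialMap, translate_eq_mapDomain,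
    monomialMap_apply, monomialMap_apply, ← Finsupp.mapDomain_comp]
  simp only [comp_def, map_mul]

/-- The automorphism of the wreath product given by `monomialBase M c` on the base group and by
`M` on `H`. -/
def monomialAut (M : MulAut H) (c : (ZMod n)ˣ) :
    RestrictedWreath (ZMod n) H ≃* RestrictedWreath (ZMod n) H :=
  SemidirectProduct.congr (AddEquiv.toMultiplicative (monomialBase M c)) M fun x =>
    MulEquiv.ext fun f => congrArg Multiplicative.ofAdd
      (monomialBase_translate M c x (Multiplicative.toAdd f))

theorem induces_monomialAut (M : MulAut H) (c : (ZMod n)ˣ) :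
    Induces (monomialAut M c) M (monomialBase M c) where
  map_right _ := rfl
  map_lamp _ := SemidirectProduct.ext rfl (map_one M)

theorem reidemeisterNumber_monomialAut_ne_top [Group.FG H] {M : MulAut H} {c : (ZMod n)ˣ} {s e : ℕ}
    (hM : ∀ x y, (fun y => x * M y)^[s] y = y) (hc : IsUnit (1 - (c : ZMod n) ^ s))
    (he : e ≠ 0) (hpow : ∀ y, y ^ e ∈ coboundaries M) :
    reidemeisterNumber (monomialAut M c) ≠ ⊤ := by
  have hsurj (x : H) : Surjective (twistedDiff (monomialBase M c) x) := by
    convert one_sub_monomialMap_surjective (P := fun y => x * M y) fun y => ⟨s, hM x y, hc⟩ using 1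
    ext1 f
    rw [twistedDiff_apply, monomialBase_apply, translate_monomialMap]
    rfl
  have := finite_quotient_of_pow_mem he hpow
  rw [reidemeisterNumber_eq_card (toCoinvariants_surjective M)
    ((induces_monomialAut M c).twistedConj_eq_ker_toCoinvariants hsurj)]
  exact ENat.card_lt_top_of_finite.ne

theorem exists_reidemeisterNumber_ne_top_of_coprime_six [Group.FG H] (hn : Nat.Coprime n 6) :
    ∃ φ : RestrictedWreath (ZMod n) H ≃* RestrictedWreath (ZMod n) H, reidemeisterNumber φ ≠ ⊤ := by
  have h2 : Nat.Coprime 2 n := (hn.coprime_dvd_right (by norm_num)).symm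
  have h3 : Nat.Coprime 3 n := (hn.coprime_dvd_right (by norm_num)).symm
  let c : (ZMod n)ˣ := ZMod.unitOfCoprime 2 h2
  have hc : 1 - (c : ZMod n) ^ 2 = -(ZMod.unitOfCoprime 3 h3 : (ZMod n)ˣ) := by
    simp only [c, ZMod.coe_unitOfCoprime]
    norm_num
  refine ⟨monomialAut (MulEquiv.inv H) c, reidemeisterNumber_monomialAut_ne_top (s := 2)
    (fun x y => ?_) (hc ▸ (Units.isUnit _).neg) two_ne_zero fun y => mem_coboundaries.2 ⟨y, ?_⟩⟩
  · simp
  · rw [MulEquiv.inv_apply, div_inv_eq_mul, sq]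

section OrderThree

variable {M : MulAut H}

theorem iterate_three_mul_apply_of_mul_eq_one (hM : ∀ y, y * M y * M (M y) = 1) (x y : H) :
    (fun y => x * M y)^[3] y = y := by
  have hM3 : M (M (M y)) = y := by
    refine mul_left_cancel ((hM (M y)).trans ?_)
    rw [mul_comm, ← mul_assoc, hM]
  calc x * M (x * M (x * M y)) = x * M x * M (M x) * M (M (M y)) := by
        simp only [map_mul, mul_assoc]
    _ = y := by rw [hM, hM3, one_mul]

theorem cube_mem_coboundaries_of_mul_eq_one (hM : ∀ y, y * M y * M (M y) = 1) (y : H) :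
    y ^ 3 ∈ coboundaries M := by
  refine mem_coboundaries.2 ⟨y ^ 2 * M y, div_eq_iff_eq_mul.2 ?_⟩
  calc y ^ 2 * M y = y ^ 2 * M y * (y * (M y * M (M y))) := by rw [← mul_assoc y, hM, mul_one]
    _ = y ^ 3 * M (y ^ 2 * M y) := by
        rw [mul_mul_mul_comm, ← pow_succ, ← mul_assoc (M y), ← sq, map_mul, map_pow]

theorem exists_mulAut_mul_eq_one {K : Type*} [CommGroup K] (e : H ≃* K × K) :
    ∃ M : MulAut H, ∀ y, y * M y * M (M y) = 1 := by
  let μ : MulAut (K × K) :=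
    { toFun := fun v => (v.2⁻¹, v.1 / v.2)
      invFun := fun v => (v.2 / v.1, v.1⁻¹)
      left_inv := fun v => by simp
      right_inv := fun v => by simp
      map_mul' := fun v w => by simp [mul_comm, mul_div_mul_comm] }
  have hμ (v : K × K) : v * μ v * μ (μ v) = 1 := by
    ext <;> simp [μ, div_eq_mul_inv, mul_comm, mul_left_comm]
  exact ⟨MulAut.congr e.symm μ, fun y => e.injective (by simpa using hμ (e y))⟩

end OrderThree

theorem exists_reidemeisterNumber_ne_top_of_coprime_two [Group.FG H] (hn : Nat.Coprime n 2)
    {K : Type*} [CommGroup K] (e : H ≃* K × K) :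
    ∃ φ : RestrictedWreath (ZMod n) H ≃* RestrictedWreath (ZMod n) H, reidemeisterNumber φ ≠ ⊤ := by
  obtain ⟨M, hM⟩ := exists_mulAut_mul_eq_one e
  have hc : 1 - ((-1 : (ZMod n)ˣ) : ZMod n) ^ 3 = ZMod.unitOfCoprime 2 hn.symm := by
    rw [ZMod.coe_unitOfCoprime, Units.val_neg, Units.val_one]
    norm_num
  exact ⟨monomialAut M (-1), reidemeisterNumber_monomialAut_ne_top
    (iterate_three_mul_apply_of_mul_eq_one hM) (hc ▸ Units.isUnit _) three_ne_zero
    (cube_mem_coboundaries_of_mul_eq_one hM)⟩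

end Existence

section Lamplighter

variable {n k : ℕ}

theorem two_dvd_of_three_dvd_of_reidemeisterNumber_ne_top [NeZero k]
    {φ : Lamplighter n k ≃* Lamplighter n k}
    (hR : reidemeisterNumber φ ≠ ⊤) (h3 : 3 ∣ n) : 2 ∣ k := by
  have heven := even_finrank_of_three_dvd hR h3
  rw [show Module.finrank ℤ (Additive (Multiplicative (Fin k → ℤ))) = k from
    Module.finrank_fin_fun ℤ] at heven
  exact heven.two_dvd

/-- The splitting `ℤ^(2l) ≅ ℤ^l × ℤ^l`, written multiplicatively. -/
def finTwoMulMulEquiv (l : ℕ) : Multiplicative (Fin (2 * l) → ℤ) ≃*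
    Multiplicative (Fin l → ℤ) × Multiplicative (Fin l → ℤ) :=
  (AddEquiv.toMultiplicative
    ((LinearEquiv.funCongrLeft ℤ ℤ (finSumFinEquiv.trans (finCongr (two_mul l).symm))).trans
      (LinearEquiv.sumArrowLequivProdArrow (Fin l) (Fin l) ℤ ℤ)).toAddEquiv).trans
    (MulEquiv.prodMultiplicative _ _)

theorem mainTheorem8_general (hk : 0 < k) (n : ℕ) :
    TBFTf (Lamplighter n k) ∧
      ((∃ φ : Lamplighter n k ≃* Lamplighter n k, reidemeisterNumber φ ≠ ⊤) ↔
        ((∃ m l : ℕ, Nat.gcd m 2 = 1 ∧ n = 3 * m ∧ k = 2 * l) ∨ Nat.gcd n 6 = 1)) := by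
  have : NeZero k := ⟨hk.ne'⟩
  refine ⟨tbftf_restrictedWreath, ?_, ?_⟩
  · rintro ⟨φ, hR⟩
    have hn2 : Nat.Coprime n 2 := ((Nat.Prime.coprime_iff_not_dvd Nat.prime_two).2
      (not_two_dvd_of_reidemeisterNumber_ne_top hR)).symm
    by_cases h3 : 3 ∣ n
    · obtain ⟨l, rfl⟩ := two_dvd_of_three_dvd_of_reidemeisterNumber_ne_top hR h3
      obtain ⟨m, rfl⟩ := h3
      exact Or.inl ⟨m, l, hn2.coprime_mul_left, rfl, rfl⟩
    · have hn3 : Nat.Coprime n 3 := ((Nat.Prime.coprime_iff_not_dvd Nat.prime_three).2 h3).symm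
      exact Or.inr (hn2.mul_right hn3)
  · rintro (⟨m, l, hm, rfl, rfl⟩ | hn)
    · exact exists_reidemeisterNumber_ne_top_of_coprime_two
        (Nat.Coprime.mul_left (by norm_num) hm) (finTwoMulMulEquiv l)
    · exact exists_reidemeisterNumber_ne_top_of_coprime_six hn

end Lamplighter

end TwistedBurnside

end

theorem mainTheorem8 :
    (∀ k n : ℕ, 0 < k → 0 < n → Nat.gcd n 2 = 1 →
      TwistedBurnside.TBFTf (TwistedBurnside.Lamplighter (3 * n) (2 * k))) ∧
    (∀ k n : ℕ, 0 < k → 0 < n → Nat.gcd n 6 = 1 →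
      TwistedBurnside.TBFTf (TwistedBurnside.Lamplighter n k)) ∧
    (∀ k n : ℕ, 0 < k → 0 < n →
      ((∃ φ : TwistedBurnside.Lamplighter n k ≃* TwistedBurnside.Lamplighter n k,
          TwistedBurnside.reidemeisterNumber φ ≠ ⊤) ↔
        ((∃ m l : ℕ, Nat.gcd m 2 = 1 ∧ n = 3 * m ∧ k = 2 * l) ∨ Nat.gcd n 6 = 1))) :=
  ⟨fun _ _ hk _ _ => (TwistedBurnside.mainTheorem8_general (by lia) _).1,
    fun _ n hk _ _ => (TwistedBurnside.mainTheorem8_general hk n).1,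
    fun _ n hk _ => (TwistedBurnside.mainTheorem8_general hk n).2⟩
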